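/- Let $n\in\mathbb N$, let $\mu_1>\mu_2>\dots>\mu_n>0$, and let $a_1,\dots,a_n\in\mathbb C\setminus\{0\}$ with $\operatorname{Re}(a_j)\ge 0$ for all $j$. Put $A=\mathrm{Diag}(a_1,\dots,a_n)$ and, for $r\in\mathbb R$, $$s(r)=\big(\sin(\mu_1 r),\dots,\sin(\mu_n r)\big)^{t},\qquad G(r)=\Big(\int_0^r\sin(\mu_i\rho)\sin(\mu_j\rho)\,d\rho\Big)_{i,j=1}^n .$$ Then $A+G(r)$ is invertible for every $r\ge 0$. Moreover, with $$v(r)=-\big(A+G(r)\big)^{-1}s(r),\qquad V(r)=2\,\frac{d}{dr}\Big(\sum_{j=1}^n\sin(\mu_j r)\,v_j(r)\Big),$$ the derivative defining $V(r)$ exists for every $r\ge0$, and $x\mapsto V(|x|)$ belongs to $L^\infty(\mathbb R^3)$, so that $-\Delta+V(|\cdot|)$ is a well-defined operator in $L^2(\mathbb R^3)=L^2(\mathbb R^3;\mathbb C)$ with domain the Sobolev space $H^2(\mathbb R^3)$. For each $j\in\{1,\dots,n\}$ the function $$u_j(x)=\frac{v_j(|x|)}{|x|}$$ (defined for $x\neq0$,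 that is, almost everywhere) is a nonzero element of $L^2(\mathbb R^3)$, belongs to $H^2(\mathbb R^3)$, and satisfies $$\big(-\Delta+V(|\cdot|)\big)u_j=\mu_j^2\,u_j .$$ In other words, $u_j$ is an eigenfunction of $-\Delta+V(|\cdot|)$ with eigenvalue $\mu_j^2$. -/

import Mathlib

open MeasureTheory TemperedDistribution
open scoped ENNReal SchwartzMap Laplacian

noncomputable section

namespace RadialSchrodinger

/-! ### The matrix, the functions `v_j` and the potential `V` on the half-line -/

/-- The real matrix `G(r)` with entries `∫₀ʳ sin(μ_i ρ) sin(μ_j ρ) dρ`. -/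
def gramMatrix {n : ℕ} (μ : Fin n → ℝ) (r : ℝ) : Matrix (Fin n) (Fin n) ℝ :=
  Matrix.of fun i j => ∫ ρ in (0 : ℝ)..r, Real.sin (μ i * ρ) * Real.sin (μ j * ρ)

/-- The complex matrix `A + G(r)`, where `A = Diag(a_1, …, a_n)`. -/
def shiftedMatrix {n : ℕ} (μ : Fin n → ℝ) (a : Fin n → ℂ) (r : ℝ) :
    Matrix (Fin n) (Fin n) ℂ :=
  Matrix.diagonal a + (gramMatrix μ r).map (fun t : ℝ => (t : ℂ))

/-- The vector `s(r)` with components `sin(μ_j r)`. -/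
def sinVec {n : ℕ} (μ : Fin n → ℝ) (r : ℝ) : Fin n → ℂ :=
  fun j => ((Real.sin (μ j * r) : ℝ) : ℂ)

/-- The vector `v(r) = -(A + G(r))⁻¹ s(r)`. -/
def vFun {n : ℕ} (μ : Fin n → ℝ) (a : Fin n → ℂ) (r : ℝ) : Fin n → ℂ :=
  -(Matrix.mulVec (shiftedMatrix μ a r)⁻¹ (sinVec μ r))

/-- The function `r ↦ ∑_j sin(μ_j r) v_j(r)`. -/
def sinDotV {n : ℕ} (μ : Fin n → ℝ) (a : Fin n → ℂ) (r : ℝ) : ℂ :=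
  ∑ j, ((Real.sin (μ j * r) : ℝ) : ℂ) * vFun μ a r j

/-- The potential `V(r) = 2 (∑_j sin(μ_j ·) v_j(·))'(r)`. -/
def potential {n : ℕ} (μ : Fin n → ℝ) (a : Fin n → ℂ) (r : ℝ) : ℂ :=
  2 * deriv (sinDotV μ a) r

/-! ### The operator `-Δ + q` in `L²(ℝ³)` with domain `H²(ℝ³)` -/

/-- Three-dimensional Euclidean space. -/
abbrev R3 : Type := EuclideanSpace ℝ (Fin 3)

/-- The complex Hilbert space `L²(ℝ³)`. -/
abbrev L2R3 : Type := Lp ℂ 2 (volume : Measure R3)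

/-- The function `u_j(x) = v_j(|x|) / |x|` on `ℝ³`. -/
def uFun {n : ℕ} (μ : Fin n → ℝ) (a : Fin n → ℂ) (j : Fin n) (x : R3) : ℂ :=
  vFun μ a ‖x‖ j / ((‖x‖ : ℝ) : ℂ)

/-- The Sobolev space `H²(ℝ³)`, as a linear subspace of `L²(ℝ³)`. -/
def sobolevH2 : Submodule ℂ L2R3 where
  carrier := {f | MemSobolev 2 2 (f : 𝓢'(R3, ℂ))}
  add_mem' {f g} hf hg := by
    have h := MemSobolev.add hf hg
    simp only [← Lp.toTemperedDistributionCLM_apply, ← map_add] at h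
    exact h
  zero_mem' := by
    have h := memSobolev_fun_zero R3 ℂ 2 2
    rw [← map_zero (Lp.toTemperedDistributionCLM ℂ (volume : Measure R3) 2)] at h
    exact h
  smul_mem' c f hf := by
    have h := MemSobolev.smul c hf
    simp only [← Lp.toTemperedDistributionCLM_apply, ← map_smul] at h
    exact h

theorem toTemperedDistribution_injective {f g : L2R3}
    (h : (f : 𝓢'(R3, ℂ)) = (g : 𝓢'(R3, ℂ))) : f = g := by
  have hk := Lp.ker_toTemperedDistributionCLM_eq_bot (F := ℂ) (μ := (volume : Measure R3))
    (p := 2)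
  exact LinearMap.ker_eq_bot.mp hk h

theorem exists_laplacian (f : sobolevH2) :
    ∃ g : L2R3, Δ ((f : L2R3) : 𝓢'(R3, ℂ)) = (g : 𝓢'(R3, ℂ)) := by
  have h : MemSobolev 2 2 ((f : L2R3) : 𝓢'(R3, ℂ)) := f.2
  have h' := h.laplacian
  rw [sub_self] at h'
  exact memSobolev_zero_iff.mp h'

/-- The Laplacian `Δ : H²(ℝ³) → L²(ℝ³)`: its value at `f` is the element of `L²(ℝ³)` that
represents the distributional Laplacian of `f`. -/
def laplacianH2 : sobolevH2 →ₗ[ℂ] L2R3 where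
  toFun f := (exists_laplacian f).choose
  map_add' f g := by
    apply toTemperedDistribution_injective
    have hf := (exists_laplacian f).choose_spec
    have hg := (exists_laplacian g).choose_spec
    rw [← (exists_laplacian (f + g)).choose_spec]
    simp only [← Lp.toTemperedDistributionCLM_apply, ← laplacianCLM_apply] at hf hg ⊢
    rw [map_add, ← hf, ← hg, Submodule.coe_add, map_add, map_add]
  map_smul' c f := by
    apply toTemperedDistribution_injective
    have hf := (exists_laplacian f).choose_spec
    rw [← (exists_laplacian (c • f)).choose_spec]
    simp only [← Lp.toTemperedDistributionCLM_apply, ← laplacianCLM_apply] at hf ⊢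
    rw [RingHom.id_apply, map_smul, ← hf, Submodule.coe_smul, map_smul, map_smul]

theorem laplacianH2_spec (f : sobolevH2) :
    Δ ((f : L2R3) : 𝓢'(R3, ℂ)) = ((laplacianH2 f : L2R3) : 𝓢'(R3, ℂ)) :=
  (exists_laplacian f).choose_spec

/-- Multiplication by `q ∈ L^∞(ℝ³)`, as a bounded operator on `L²(ℝ³)`. -/
def mulOp (q : Lp ℂ ∞ (volume : Measure R3)) : L2R3 →L[ℂ] L2R3 :=
  (ContinuousLinearMap.mul ℂ ℂ).holderL volume ∞ 2 2 q

theorem mulOp_coeFn (q : Lp ℂ ∞ (volume : Measure R3)) (f : L2R3) :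
    mulOp q f =ᵐ[volume] fun x => q x * f x :=
  ContinuousLinearMap.coeFn_holder (ContinuousLinearMap.mul ℂ ℂ) q f

/-- The operator `-Δ + q` in `L²(ℝ³)`, with domain `H²(ℝ³)`, for `q ∈ L^∞(ℝ³)`. -/
def schrodingerOp (q : Lp ℂ ∞ (volume : Measure R3)) : L2R3 →ₗ.[ℂ] L2R3 where
  domain := sobolevH2
  toFun := -laplacianH2 + (mulOp q).toLinearMap ∘ₗ sobolevH2.subtype

end RadialSchrodinger

end

/-! Write `M = A + G(r)`, `s` for the sine vector, `c = s'`, `σ = s·v`, `D = Diag(μ)`.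
Invertibility: pairing `M x = 0` with the conjugate of `x` and taking real parts gives `∑
Re(a_i)|x_i|² + ∫₀ʳ |∑ x_j sin(μ_j ρ)|² dρ = 0`. So the sine sum vanishes on `[0, r]`, and `x = 0`
by independence of the sines (`isUnit_shiftedMatrix`).

Radial equation: `M' = s sᵗ` has rank one, and `G D² - D² G = c sᵗ - s cᵗ`. Differentiating `M v =
-s` twice and using this commutator gives `v_j'' = (V - μ_j²) v_j` (`hasDerivAt_vDeriv`).

Size: `G(r) = (r/2) I + O(1)`, so `M⁻¹ = O(1/(1+r))` (`exists_one_add_mul_norm_le`). Hence `v =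
O(1/(1+r))`, while `v'` and `V` are bounded. Since `v(0) = 0`, `u_j` is bounded near the origin and
`O(|x|⁻²)` at infinity, hence square integrable in dimension three.

Passage to `ℝ³`: `f(|x|)/|x|` has distributional Laplacian `f''(|x|)/|x|`, with no point mass at the
origin because `f(0) = 0` (`IsRadialProfile.integral_mul_laplacian`). Thus `Δu_j = (V - μ_j²) u_j`
lies in `L²`, which forces `u_j ∈ H²`. Finally `a_j v_j'(0) = -μ_j ≠ 0`, so `u_j` is nonzero. -/

namespace RadialSchrodinger

/-! ### Differentiating and bounding inverses of matrix-valued functions -/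

section Inverse

open scoped Matrix.Norms.Operator

variable {ι : Type*} [Fintype ι] [DecidableEq ι]

/-- Stated entrywise so that the operator norm, which the proof needs to differentiate
`Ring.inverse`, stays local to this section. -/
theorem hasDerivAt_matrix_inv_apply {M : ℝ → Matrix ι ι ℂ} {M' : Matrix ι ι ℂ} {r : ℝ}
    (hM : ∀ i j, HasDerivAt (fun t => M t i j) (M' i j) r) (hr : IsUnit (M r)) (i j : ι) :
    HasDerivAt (fun t => (M t)⁻¹ i j) (-((M r)⁻¹ * M' * (M r)⁻¹) i j) r := by
  have h1 : HasDerivAt M M' r := by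
    have h : HasDerivAt (fun t => ∑ i, ∑ j, M t i j • Matrix.single i j (1 : ℂ))
        (∑ i, ∑ j, M' i j • Matrix.single i j (1 : ℂ)) r :=
      HasDerivAt.fun_sum fun i _ => HasDerivAt.fun_sum fun j _ => (hM i j).smul_const _
    convert h using 1
    · funext t
      conv_lhs => rw [Matrix.matrix_eq_sum_single (M t)]
      simp
    · conv_lhs => rw [Matrix.matrix_eq_sum_single M']
      simp
  obtain ⟨u, hu⟩ := hr
  have h2 := hasFDerivAt_ringInverse (𝕜 := ℝ) u
  rw [hu] at h2
  have h3 := h2.comp_hasDerivAt r h1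
  let e : Matrix ι ι ℂ →ₗ[ℝ] ℂ :=
    { toFun := fun N => N i j, map_add' := fun _ _ => rfl, map_smul' := fun _ _ => rfl }
  have h4 := (LinearMap.toContinuousLinearMap e).hasFDerivAt.comp_hasDerivAt r h3
  have h5 : (↑u⁻¹ : Matrix ι ι ℂ) = (M r)⁻¹ := by
    rw [← hu, Matrix.coe_units_inv]
  have h6 : (fun t => (M t)⁻¹ i j) = LinearMap.toContinuousLinearMap e ∘ Ring.inverse ∘ M := by
    funext t
    simp only [Function.comp_apply, ← Matrix.nonsing_inv_eq_ringInverse]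
    rfl
  rw [h6]
  refine h4.congr_deriv ?_
  rw [h5]
  rfl

theorem hasDerivAt_inv_mulVec {M : ℝ → Matrix ι ι ℂ} {M' : Matrix ι ι ℂ} {r : ℝ}
    {b : ℝ → ι → ℂ} {b' : ι → ℂ}
    (hM : ∀ i j, HasDerivAt (fun t => M t i j) (M' i j) r) (hr : IsUnit (M r))
    (hb : HasDerivAt b b' r) :
    HasDerivAt (fun t => Matrix.mulVec (M t)⁻¹ (b t))
      (Matrix.mulVec (M r)⁻¹ (b' - Matrix.mulVec M' (Matrix.mulVec (M r)⁻¹ (b r)))) r := by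
  rw [hasDerivAt_pi] at hb ⊢
  intro i
  have h : HasDerivAt (fun t => ∑ j, (M t)⁻¹ i j * b t j)
      (∑ j, (-((M r)⁻¹ * M' * (M r)⁻¹) i j * b r j + (M r)⁻¹ i j * b' j)) r :=
    HasDerivAt.fun_sum fun j _ => (hasDerivAt_matrix_inv_apply hM hr i j).mul (hb j)
  refine h.congr_deriv ?_
  rw [Finset.sum_add_distrib, Matrix.mulVec_sub, Matrix.mulVec_mulVec, Matrix.mulVec_mulVec]
  simp only [Matrix.mulVec, dotProduct, Pi.sub_apply, neg_mul, Finset.sum_neg_distrib]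
  ring

theorem exists_bound_of_isUnit_on_compact {M : ℝ → Matrix ι ι ℂ} {M' : ℝ → Matrix ι ι ℂ}
    {K : Set ℝ} (hK : IsCompact K)
    (hM : ∀ r i j, HasDerivAt (fun t => M t i j) (M' r i j) r) (hr : ∀ r ∈ K, IsUnit (M r)) :
    ∃ C : ℝ, 0 ≤ C ∧ ∀ r ∈ K, ∀ x : ι → ℂ, ‖x‖ ≤ C * ‖Matrix.mulVec (M r) x‖ := by
  have hc : ContinuousOn (fun r => ∑ i, ∑ j, ‖(M r)⁻¹ i j‖) K := by
    refine continuousOn_finsetSum _ fun i _ => continuousOn_finsetSum _ fun j _ => ?_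
    exact fun r h => ((hasDerivAt_matrix_inv_apply (hM r) (hr r h) i j).continuousAt.norm).continuousWithinAt
  obtain ⟨C, hC⟩ := hK.exists_bound_of_continuousOn hc
  refine ⟨max C 0, le_max_right _ _, fun r h x => ?_⟩
  have h1 : x = Matrix.mulVec (M r)⁻¹ (Matrix.mulVec (M r) x) := by
    rw [Matrix.mulVec_mulVec, Matrix.nonsing_inv_mul _ ((Matrix.isUnit_iff_isUnit_det _).1 (hr r h)),
      Matrix.one_mulVec]
  set y := Matrix.mulVec (M r) x
  have h2 : ‖x‖ ≤ (∑ i, ∑ j, ‖(M r)⁻¹ i j‖) * ‖y‖ := by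
    refine (pi_norm_le_iff_of_nonneg (by positivity)).2 fun i => ?_
    rw [h1]
    calc ‖∑ j, (M r)⁻¹ i j * y j‖ ≤ ∑ j, ‖(M r)⁻¹ i j‖ * ‖y‖ := by
          refine (norm_sum_le _ _).trans (Finset.sum_le_sum fun j _ => ?_)
          rw [norm_mul]
          gcongr
          exact norm_le_pi_norm y j
      _ = (∑ j, ‖(M r)⁻¹ i j‖) * ‖y‖ := by rw [Finset.sum_mul]
      _ ≤ _ := by
          refine mul_le_mul_of_nonneg_right ?_ (norm_nonneg y)
          exact Finset.single_le_sum (f := fun i => ∑ j, ‖(M r)⁻¹ i j‖)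
            (fun i _ => by positivity) (Finset.mem_univ i)
  refine h2.trans ?_
  gcongr
  exact (le_abs_self _).trans ((hC r h).trans (le_max_left _ _))

end Inverse

/-! ### The Gram matrix: entries, growth, invertibility of `A + G(r)` -/

variable {n : ℕ} {μ : Fin n → ℝ} {a : Fin n → ℂ}

theorem hasDerivAt_gramMatrix_apply (μ : Fin n → ℝ) (i j : Fin n) (r : ℝ) :
    HasDerivAt (fun t => gramMatrix μ t i j) (Real.sin (μ i * r) * Real.sin (μ j * r)) r := by
  have h : Continuous fun ρ : ℝ => Real.sin (μ i * ρ) * Real.sin (μ j * ρ) := by fun_prop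
  simpa [gramMatrix] using (h.integral_hasStrictDerivAt 0 r).hasDerivAt

theorem hasDerivAt_sin_mul (c r : ℝ) :
    HasDerivAt (fun t => Real.sin (c * t)) (c * Real.cos (c * r)) r := by
  simpa [mul_comm] using ((hasDerivAt_id r).const_mul c).sin

theorem hasDerivAt_cos_mul (c r : ℝ) :
    HasDerivAt (fun t => Real.cos (c * t)) (-(c * Real.sin (c * r))) r := by
  simpa [mul_comm] using ((hasDerivAt_id r).const_mul c).cos

/-- The right side is a Wronskian of the two sines, zero at `r = 0`. Leaving the factor undivided
keeps `i = j` included; the identity serves both the off-diagonal bounds and the commutator of `G`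
with `D²`. -/
theorem gramMatrix_apply_mul_sub (μ : Fin n → ℝ) (r : ℝ) (i j : Fin n) :
    gramMatrix μ r i j * (μ j ^ 2 - μ i ^ 2) =
      μ i * Real.cos (μ i * r) * Real.sin (μ j * r)
        - μ j * Real.sin (μ i * r) * Real.cos (μ j * r) := by
  have h := intervalIntegral.integral_eq_sub_of_hasDerivAt (a := 0) (b := r)
    (f := fun t => μ i * Real.cos (μ i * t) * Real.sin (μ j * t)
        - μ j * Real.sin (μ i * t) * Real.cos (μ j * t))
    (f' := fun t => Real.sin (μ i * t) * Real.sin (μ j * t) * (μ j ^ 2 - μ i ^ 2))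
    (fun t _ => by
      refine ((((hasDerivAt_cos_mul (μ i) t).const_mul (μ i)).mul
        (hasDerivAt_sin_mul (μ j) t)).sub (((hasDerivAt_sin_mul (μ i) t).const_mul (μ j)).mul
          (hasDerivAt_cos_mul (μ j) t))).congr_deriv ?_
      ring)
    (Continuous.intervalIntegrable (by fun_prop) _ _)
  rw [intervalIntegral.integral_mul_const] at h
  simpa [gramMatrix] using h

theorem gramMatrix_apply_self {i : Fin n} (hi : μ i ≠ 0) (r : ℝ) :
    gramMatrix μ r i i = r / 2 - Real.sin (μ i * r) * Real.cos (μ i * r) / (2 * μ i) := by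
  have h := intervalIntegral.integral_eq_sub_of_hasDerivAt (a := 0) (b := r)
    (f := fun t => t / 2 - Real.sin (μ i * t) * Real.cos (μ i * t) / (2 * μ i))
    (f' := fun t => Real.sin (μ i * t) * Real.sin (μ i * t))
    (fun t _ => by
      refine (((hasDerivAt_id t).div_const 2).sub (((hasDerivAt_sin_mul (μ i) t).mul
        (hasDerivAt_cos_mul (μ i) t)).div_const (2 * μ i))).congr_deriv ?_
      have := Real.sin_sq_add_cos_sq (μ i * t)
      field_simp
      linear_combination -this)
    (Continuous.intervalIntegrable (by fun_prop) _ _)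
  simpa [gramMatrix] using h

theorem exists_bound_gramMatrix_sub (hμ : StrictAnti μ) (hμ_pos : ∀ j, 0 < μ j) :
    ∃ C : ℝ, 0 ≤ C ∧ ∀ r i j, |gramMatrix μ r i j - if i = j then r / 2 else 0| ≤ C := by
  have key : ∀ i j, ∃ C : ℝ, ∀ r, |gramMatrix μ r i j - if i = j then r / 2 else 0| ≤ C := by
    intro i j
    by_cases hij : i = j
    · subst hij
      refine ⟨1 / (2 * μ i), fun r => ?_⟩
      have hi := hμ_pos i
      rw [gramMatrix_apply_self hi.ne', if_pos rfl, sub_sub_cancel_left, abs_neg, abs_div, abs_mul,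
        abs_of_pos (by positivity : 0 < 2 * μ i)]
      gcongr
      exact mul_le_one₀ (Real.abs_sin_le_one _) (abs_nonneg _) (Real.abs_cos_le_one _)
    · have hne : μ j ^ 2 - μ i ^ 2 ≠ 0 := by
        rw [sub_ne_zero]
        intro h
        exact hij (hμ.injective ((sq_eq_sq₀ (hμ_pos j).le (hμ_pos i).le).1 h)).symm
      refine ⟨(μ i + μ j) / |μ j ^ 2 - μ i ^ 2|, fun r => ?_⟩
      rw [if_neg hij, sub_zero, le_div_iff₀ (abs_pos.2 hne), ← abs_mul, gramMatrix_apply_mul_sub]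
      have hi := hμ_pos i
      have hj := hμ_pos j
      refine (abs_sub _ _).trans (add_le_add ?_ ?_)
      · rw [abs_mul, abs_mul, abs_of_pos hi, mul_assoc]
        exact mul_le_of_le_one_right hi.le
          (mul_le_one₀ (Real.abs_cos_le_one _) (abs_nonneg _) (Real.abs_sin_le_one _))
      · rw [abs_mul, abs_mul, abs_of_pos hj, mul_assoc]
        exact mul_le_of_le_one_right hj.le
          (mul_le_one₀ (Real.abs_sin_le_one _) (abs_nonneg _) (Real.abs_cos_le_one _))
  choose C hC using key
  refine ⟨∑ i, ∑ j, |C i j|, by positivity, fun r i j => ?_⟩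
  calc _ ≤ |C i j| := (hC i j r).trans (le_abs_self _)
    _ ≤ ∑ j, |C i j| := Finset.single_le_sum (f := fun j => |C i j|)
          (fun _ _ => abs_nonneg _) (Finset.mem_univ j)
    _ ≤ _ := Finset.single_le_sum (f := fun i => ∑ j, |C i j|)
          (fun _ _ => by positivity) (Finset.mem_univ i)

theorem shiftedMatrix_mulVec_apply (μ : Fin n → ℝ) (a : Fin n → ℂ) (r : ℝ) (x : Fin n → ℂ)
    (i : Fin n) :
    Matrix.mulVec (shiftedMatrix μ a r) x i = a i * x i + ∑ j, (gramMatrix μ r i j : ℂ) * x j := by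
  rw [shiftedMatrix, Matrix.add_mulVec, Pi.add_apply, Matrix.mulVec_diagonal]
  rfl

/-- `A + G(r)` differs from `(r/2) I` by a matrix bounded in `r`. Nothing is assumed on `a`, so `a =
0` is available for the independence of the sines. -/
theorem exists_half_mul_norm_le (hμ : StrictAnti μ) (hμ_pos : ∀ j, 0 < μ j) (a : Fin n → ℂ) :
    ∃ C : ℝ, 0 ≤ C ∧ ∀ r, 0 ≤ r → ∀ x : Fin n → ℂ,
      r / 2 * ‖x‖ ≤ ‖Matrix.mulVec (shiftedMatrix μ a r) x‖ + C * ‖x‖ := by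
  obtain ⟨C, hC0, hC⟩ := exists_bound_gramMatrix_sub hμ hμ_pos
  refine ⟨‖a‖ + n * C, by positivity, fun r hr x => ?_⟩
  rw [← abs_of_nonneg (by positivity : 0 ≤ r / 2), ← Real.norm_eq_abs, ← norm_smul]
  refine (pi_norm_le_iff_of_nonneg (by positivity)).2 fun i => ?_
  have h : ((r / 2) • x) i = Matrix.mulVec (shiftedMatrix μ a r) x i - (a i * x i
      + ∑ j, ((gramMatrix μ r i j - if i = j then r / 2 else 0 : ℝ) : ℂ) * x j) := by
    rw [shiftedMatrix_mulVec_apply]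
    have : ∑ j, ((gramMatrix μ r i j - if i = j then r / 2 else 0 : ℝ) : ℂ) * x j
        = ∑ j, (gramMatrix μ r i j : ℂ) * x j - ((r / 2 : ℝ) : ℂ) * x i := by
      simp only [Complex.ofReal_sub, sub_mul, Finset.sum_sub_distrib]
      congr 1
      rw [Finset.sum_eq_single i]
      · simp
      · intro j _ hj
        simp [hj.symm]
      · simp
    rw [this, Pi.smul_apply, Complex.real_smul]
    ring
  rw [h]
  refine (norm_sub_le _ _).trans (add_le_add (norm_le_pi_norm _ i) ?_)
  rw [add_mul]
  refine (norm_add_le _ _).trans (add_le_add ?_ ?_)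
  · rw [norm_mul]
    gcongr <;> exact norm_le_pi_norm _ i
  · calc _ ≤ ∑ j : Fin n, C * ‖x‖ := by
          refine (norm_sum_le _ _).trans (Finset.sum_le_sum fun j _ => ?_)
          rw [norm_mul, Complex.norm_real]
          exact mul_le_mul (hC r i j) (norm_le_pi_norm x j) (norm_nonneg _) hC0
      _ = _ := by simp [mul_assoc]

theorem gramMatrix_sum_mul (μ : Fin n → ℝ) (r : ℝ) (x : Fin n → ℂ) (i : Fin n) :
    ∑ j, (gramMatrix μ r i j : ℂ) * x j =
      ∫ ρ in (0 : ℝ)..r, (Real.sin (μ i * ρ) : ℂ) * ∑ j, x j * (Real.sin (μ j * ρ) : ℂ) := by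
  simp_rw [Finset.mul_sum]
  rw [intervalIntegral.integral_finsetSum
    (fun j _ => Continuous.intervalIntegrable (by fun_prop) _ _)]
  refine Finset.sum_congr rfl fun j _ => ?_
  rw [gramMatrix, Matrix.of_apply, ← intervalIntegral.integral_ofReal,
    ← intervalIntegral.integral_mul_const]
  congr 1
  funext ρ
  push_cast
  ring

theorem sum_conj_mul_gramMatrix (μ : Fin n → ℝ) (r : ℝ) (x : Fin n → ℂ) :
    ∑ i, (starRingEnd ℂ) (x i) * ∑ j, (gramMatrix μ r i j : ℂ) * x j =
      ((∫ ρ in (0 : ℝ)..r, ‖∑ j, x j * (Real.sin (μ j * ρ) : ℂ)‖ ^ 2 : ℝ) : ℂ) := by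
  simp_rw [gramMatrix_sum_mul, ← intervalIntegral.integral_const_mul]
  rw [← intervalIntegral.integral_finsetSum
    (fun j _ => Continuous.intervalIntegrable (by fun_prop) _ _), ← intervalIntegral.integral_ofReal]
  congr 1
  funext ρ
  rw [Complex.ofReal_pow, ← Complex.conj_mul', map_sum, Finset.sum_mul]
  refine Finset.sum_congr rfl fun j _ => ?_
  rw [map_mul, Complex.conj_ofReal]
  ring

/-- By analyticity the sum vanishes on all of `ℝ`, so `G(R) x = 0` for every `R`, which contradicts
the growth of `G` unless `x = 0`. -/
theorem eq_zero_of_sum_sin_eq_zero (hμ : StrictAnti μ) (hμ_pos : ∀ j, 0 < μ j) {x : Fin n → ℂ}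
    {r : ℝ} (hr : 0 < r)
    (h : ∀ ρ ∈ Set.Icc 0 r, ∑ j, x j * (Real.sin (μ j * ρ) : ℂ) = 0) : x = 0 := by
  have han : AnalyticOnNhd ℝ (fun ρ : ℝ => ∑ j, x j * (Real.sin (μ j * ρ) : ℂ)) Set.univ := by
    intro ρ _
    refine Finset.analyticAt_fun_sum _ fun j _ => analyticAt_const.mul ?_
    exact (Complex.ofRealCLM.analyticAt _).comp
      (Real.analyticAt_sin.comp (analyticAt_const.mul analyticAt_id))
  have h0 : ∀ ρ : ℝ, ∑ j, x j * (Real.sin (μ j * ρ) : ℂ) = 0 := by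
    have := han.eqOn_zero_of_preconnected_of_eventuallyEq_zero isPreconnected_univ
      (Set.mem_univ (r / 2)) (by
        filter_upwards [Icc_mem_nhds (by linarith : 0 < r / 2) (by linarith : r / 2 < r)] with ρ hρ
        exact h ρ hρ)
    exact fun ρ => this (Set.mem_univ ρ)
  obtain ⟨C, hC0, hC⟩ := exists_half_mul_norm_le hμ hμ_pos 0
  -- At `R = 2(C + 1)` the factor `R/2` exceeds `C` by one, leaving `‖x‖ ≤ 0`.
  have h1 := hC (2 * (C + 1)) (by positivity) x
  have h2 : Matrix.mulVec (shiftedMatrix μ 0 (2 * (C + 1))) x = 0 := by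
    funext i
    rw [shiftedMatrix_mulVec_apply, gramMatrix_sum_mul]
    simp only [h0, mul_zero, intervalIntegral.integral_zero, Pi.zero_apply, zero_mul, add_zero]
  rw [h2, norm_zero] at h1
  exact norm_le_zero_iff.1 (by linarith)

theorem isUnit_shiftedMatrix (hμ : StrictAnti μ) (hμ_pos : ∀ j, 0 < μ j)
    (ha : ∀ j, a j ≠ 0) (ha_re : ∀ j, 0 ≤ (a j).re) {r : ℝ} (hr : 0 ≤ r) :
    IsUnit (shiftedMatrix μ a r) := by
  rw [← Matrix.mulVec_injective_iff_isUnit]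
  refine (injective_iff_map_eq_zero (Matrix.mulVecLin (shiftedMatrix μ a r))).2 fun x hx => ?_
  rw [Matrix.mulVecLin_apply] at hx
  have hx' : ∀ i, a i * x i + ∑ j, (gramMatrix μ r i j : ℂ) * x j = 0 := fun i => by
    rw [← shiftedMatrix_mulVec_apply, hx, Pi.zero_apply]
  -- `G(0) = 0`, so at the origin `a_j ≠ 0` is what gives injectivity; for `r > 0` the sign of the
  -- real parts suffices.
  rcases hr.eq_or_lt with rfl | hr
  · funext i
    simpa [gramMatrix, ha i] using hx' i
  refine eq_zero_of_sum_sin_eq_zero hμ hμ_pos hr ?_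
  have h1 : ∑ i, (a i).re * ‖x i‖ ^ 2
      + ∫ ρ in (0 : ℝ)..r, ‖∑ j, x j * (Real.sin (μ j * ρ) : ℂ)‖ ^ 2 = 0 := by
    have h2 : ∑ i, (starRingEnd ℂ) (x i) * (a i * x i + ∑ j, (gramMatrix μ r i j : ℂ) * x j) = 0 :=
      Finset.sum_eq_zero fun i _ => by rw [hx' i, mul_zero]
    simp_rw [mul_add] at h2
    rw [Finset.sum_add_distrib, sum_conj_mul_gramMatrix] at h2
    have h3 := congrArg Complex.re h2
    rw [Complex.add_re, Complex.ofReal_re, Complex.re_sum, Complex.zero_re] at h3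
    refine Eq.trans (congrArg (· + _) ?_) h3
    refine Finset.sum_congr rfl fun i _ => ?_
    rw [show (starRingEnd ℂ) (x i) * (a i * x i) = a i * ((starRingEnd ℂ) (x i) * x i) by ring,
      Complex.conj_mul', ← Complex.ofReal_pow, Complex.re_mul_ofReal]
  have h4 : 0 ≤ ∑ i, (a i).re * ‖x i‖ ^ 2 :=
    Finset.sum_nonneg fun i _ => mul_nonneg (ha_re i) (by positivity)
  intro ρ hρ
  by_contra hne
  have := intervalIntegral.integral_pos (a := 0) (b := r)
    (f := fun ρ : ℝ => ‖∑ j, x j * (Real.sin (μ j * ρ) : ℂ)‖ ^ 2) hr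
    (Continuous.continuousOn (by fun_prop)) (fun _ _ => by positivity) ⟨ρ, hρ, by positivity⟩
  linarith

theorem hasDerivAt_shiftedMatrix_apply (μ : Fin n → ℝ) (a : Fin n → ℂ) (r : ℝ) (i j : Fin n) :
    HasDerivAt (fun t => shiftedMatrix μ a t i j)
      (Matrix.vecMulVec (sinVec μ r) (sinVec μ r) i j) r := by
  have h := ((hasDerivAt_gramMatrix_apply μ i j r).ofReal_comp).const_add (Matrix.diagonal a i j)
  simpa [shiftedMatrix, Matrix.vecMulVec_apply, sinVec] using h

theorem exists_one_add_mul_norm_le (hμ : StrictAnti μ) (hμ_pos : ∀ j, 0 < μ j)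
    (ha : ∀ j, a j ≠ 0) (ha_re : ∀ j, 0 ≤ (a j).re) :
    ∃ K : ℝ, 0 ≤ K ∧ ∀ r, 0 ≤ r → ∀ x : Fin n → ℂ,
      (1 + r) * ‖x‖ ≤ K * ‖Matrix.mulVec (shiftedMatrix μ a r) x‖ := by
  obtain ⟨C, hC0, hC⟩ := exists_half_mul_norm_le hμ hμ_pos a
  -- For `r ≥ 4C + 1` one has `r/2 - C ≥ (1 + r)/4`, so the growth bound is enough; below that
  -- threshold `1 + r ≤ 2 + 4C` and compactness applies.
  obtain ⟨D, hD0, hD⟩ := exists_bound_of_isUnit_on_compact (isCompact_Icc (a := 0) (b := 4 * C + 1))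
    (hasDerivAt_shiftedMatrix_apply μ a)
    (fun r hr => isUnit_shiftedMatrix hμ hμ_pos ha ha_re hr.1)
  refine ⟨8 + (2 + 4 * C) * D, by positivity, fun r hr x => ?_⟩
  set y := Matrix.mulVec (shiftedMatrix μ a r) x with hy
  have hy0 := norm_nonneg y
  have hx0 := norm_nonneg x
  rcases le_total r (4 * C + 1) with h | h
  · have h1 := hD r ⟨hr, h⟩ x
    rw [← hy] at h1
    calc (1 + r) * ‖x‖ ≤ (2 + 4 * C) * (D * ‖y‖) := by
          exact mul_le_mul (by linarith) h1 hx0 (by linarith)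
      _ ≤ _ := by nlinarith
  · have h1 := hC r hr x
    rw [← hy] at h1
    have h2 : 0 ≤ (2 + 4 * C) * D * ‖y‖ := by positivity
    nlinarith

end RadialSchrodinger

/-! ### The radial Schrödinger equations and bounds on the half-line -/

namespace RadialSchrodinger

variable {n : ℕ} {μ : Fin n → ℝ} {a : Fin n → ℂ}

/-- The derivative of `sinVec`, with components `μ_j cos(μ_j r)`. -/
noncomputable def cosVec (μ : Fin n → ℝ) (r : ℝ) : Fin n → ℂ :=
  fun j => ((μ j * Real.cos (μ j * r) : ℝ) : ℂ)

/-- The derivative of `vFun`. -/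
noncomputable def vDeriv (μ : Fin n → ℝ) (a : Fin n → ℂ) (r : ℝ) : Fin n → ℂ :=
  Matrix.mulVec (shiftedMatrix μ a r)⁻¹ (-cosVec μ r - sinDotV μ a r • sinVec μ r)

/-- The derivative of `sinDotV`. -/
noncomputable def sinDotVDeriv (μ : Fin n → ℝ) (a : Fin n → ℂ) (r : ℝ) : ℂ :=
  cosVec μ r ⬝ᵥ vFun μ a r + sinVec μ r ⬝ᵥ vDeriv μ a r

theorem sinDotV_eq (μ : Fin n → ℝ) (a : Fin n → ℂ) (r : ℝ) :
    sinDotV μ a r = sinVec μ r ⬝ᵥ vFun μ a r := rfl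

theorem hasDerivAt_sinVec (μ : Fin n → ℝ) (r : ℝ) :
    HasDerivAt (sinVec μ) (cosVec μ r) r :=
  hasDerivAt_pi.2 fun j => (hasDerivAt_sin_mul (μ j) r).ofReal_comp

theorem hasDerivAt_cosVec (μ : Fin n → ℝ) (r : ℝ) :
    HasDerivAt (cosVec μ) (fun j => -((μ j : ℂ) ^ 2 * sinVec μ r j)) r := by
  refine hasDerivAt_pi.2 fun j => ?_
  refine (((hasDerivAt_cos_mul (μ j) r).const_mul (μ j)).ofReal_comp).congr_deriv ?_
  simp only [sinVec]
  push_cast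
  ring

theorem vecMulVec_self_mulVec (s x : Fin n → ℂ) :
    Matrix.mulVec (Matrix.vecMulVec s s) x = (s ⬝ᵥ x) • s := by
  rw [Matrix.vecMulVec_mulVec]
  funext i
  simp [mul_comm]

theorem hasDerivAt_vFun {r : ℝ} (hr : IsUnit (shiftedMatrix μ a r)) :
    HasDerivAt (vFun μ a) (vDeriv μ a r) r := by
  refine (hasDerivAt_inv_mulVec (hasDerivAt_shiftedMatrix_apply μ a r) hr
    (hasDerivAt_sinVec μ r)).neg.congr_deriv ?_
  rw [vecMulVec_self_mulVec, vDeriv, ← Matrix.mulVec_neg, sinDotV_eq, vFun, dotProduct_neg,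
    neg_smul, neg_sub, sub_neg_eq_add, neg_add_eq_sub]

theorem hasDerivAt_dotProduct {f g : ℝ → Fin n → ℂ} {f' g' : Fin n → ℂ} {r : ℝ}
    (hf : HasDerivAt f f' r) (hg : HasDerivAt g g' r) :
    HasDerivAt (fun t => f t ⬝ᵥ g t) (f' ⬝ᵥ g r + f r ⬝ᵥ g') r := by
  rw [hasDerivAt_pi] at hf hg
  refine (HasDerivAt.fun_sum (u := Finset.univ) fun j _ => (hf j).mul (hg j)).congr_deriv ?_
  rw [Finset.sum_add_distrib]
  rfl

theorem hasDerivAt_sinDotV {r : ℝ} (hr : IsUnit (shiftedMatrix μ a r)) :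
    HasDerivAt (sinDotV μ a) (sinDotVDeriv μ a r) r :=
  hasDerivAt_dotProduct (hasDerivAt_sinVec μ r) (hasDerivAt_vFun hr)

theorem potential_eq {r : ℝ} (hr : IsUnit (shiftedMatrix μ a r)) :
    potential μ a r = 2 * sinDotVDeriv μ a r := by
  rw [potential, (hasDerivAt_sinDotV hr).deriv]

theorem shiftedMatrix_mulVec_inv {r : ℝ} (hr : IsUnit (shiftedMatrix μ a r)) (x : Fin n → ℂ) :
    Matrix.mulVec (shiftedMatrix μ a r) (Matrix.mulVec (shiftedMatrix μ a r)⁻¹ x) = x := by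
  rw [Matrix.mulVec_mulVec, Matrix.mul_nonsing_inv _ ((Matrix.isUnit_iff_isUnit_det _).1 hr),
    Matrix.one_mulVec]

theorem inv_mulVec_shiftedMatrix {r : ℝ} (hr : IsUnit (shiftedMatrix μ a r)) (x : Fin n → ℂ) :
    Matrix.mulVec (shiftedMatrix μ a r)⁻¹ (Matrix.mulVec (shiftedMatrix μ a r) x) = x := by
  rw [Matrix.mulVec_mulVec, Matrix.nonsing_inv_mul _ ((Matrix.isUnit_iff_isUnit_det _).1 hr),
    Matrix.one_mulVec]

theorem shiftedMatrix_mulVec_vFun {r : ℝ} (hr : IsUnit (shiftedMatrix μ a r)) :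
    Matrix.mulVec (shiftedMatrix μ a r) (vFun μ a r) = -sinVec μ r := by
  rw [vFun, Matrix.mulVec_neg, shiftedMatrix_mulVec_inv hr]

theorem gramMatrix_mul_sq_sub (μ : Fin n → ℝ) (r : ℝ) (i j : Fin n) :
    (gramMatrix μ r i j : ℂ) * (μ j : ℂ) ^ 2 = (gramMatrix μ r i j : ℂ) * (μ i : ℂ) ^ 2
      + (cosVec μ r i * sinVec μ r j - sinVec μ r i * cosVec μ r j) := by
  have h := congrArg (fun t : ℝ => (t : ℂ)) (gramMatrix_apply_mul_sub μ r i j)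
  simp only [cosVec, sinVec]
  push_cast at h ⊢
  linear_combination h

/-- `A` is diagonal and commutes with `D²`, so `M D² v = D² M v + (c sᵗ - s cᵗ) v`, and `M v = -s`.
-/
theorem shiftedMatrix_mulVec_sq_mul_vFun {r : ℝ} (hr : IsUnit (shiftedMatrix μ a r)) (i : Fin n) :
    Matrix.mulVec (shiftedMatrix μ a r) (fun j => (μ j : ℂ) ^ 2 * vFun μ a r j) i =
      -((μ i : ℂ) ^ 2 * sinVec μ r i) + cosVec μ r i * sinDotV μ a r
        - sinVec μ r i * (cosVec μ r ⬝ᵥ vFun μ a r) := by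
  have h1 := congrFun (shiftedMatrix_mulVec_vFun hr) i
  rw [shiftedMatrix_mulVec_apply] at h1 ⊢
  have h2 : ∑ j, (gramMatrix μ r i j : ℂ) * ((μ j : ℂ) ^ 2 * vFun μ a r j) =
      (μ i : ℂ) ^ 2 * ∑ j, (gramMatrix μ r i j : ℂ) * vFun μ a r j
        + (cosVec μ r i * sinDotV μ a r - sinVec μ r i * (cosVec μ r ⬝ᵥ vFun μ a r)) := by
    rw [sinDotV_eq]
    simp only [dotProduct, Finset.mul_sum]
    rw [← Finset.sum_sub_distrib, ← Finset.sum_add_distrib]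
    refine Finset.sum_congr rfl fun j _ => ?_
    linear_combination vFun μ a r j * gramMatrix_mul_sq_sub μ r i j
  rw [h2]
  rw [Pi.neg_apply] at h1
  linear_combination (μ i : ℂ) ^ 2 * h1

/-- The components of `vFun` solve the radial Schrödinger equations. -/
theorem hasDerivAt_vDeriv {r : ℝ} (hr : IsUnit (shiftedMatrix μ a r)) :
    HasDerivAt (vDeriv μ a) (fun j => (potential μ a r - (μ j : ℂ) ^ 2) * vFun μ a r j) r := by
  refine (hasDerivAt_inv_mulVec (hasDerivAt_shiftedMatrix_apply μ a r) hr
    ((hasDerivAt_cosVec μ r).neg.sub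
      ((hasDerivAt_sinDotV hr).smul (hasDerivAt_sinVec μ r)))).congr_deriv ?_
  -- Both sides become `M⁻¹` of a vector, so only those vectors are compared, with no inverse left
  -- to expand.
  rw [← inv_mulVec_shiftedMatrix hr (fun j => (potential μ a r - (μ j : ℂ) ^ 2) * vFun μ a r j)]
  congr 1
  have h1 : (fun j => (potential μ a r - (μ j : ℂ) ^ 2) * vFun μ a r j) =
      potential μ a r • vFun μ a r - fun j => (μ j : ℂ) ^ 2 * vFun μ a r j := by
    funext j
    simp [sub_mul]
  have h2 : Matrix.mulVec (shiftedMatrix μ a r)⁻¹ ((-cosVec μ - sinDotV μ a • sinVec μ) r) =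
    vDeriv μ a r := rfl
  rw [h1, Matrix.mulVec_sub, Matrix.mulVec_smul, shiftedMatrix_mulVec_vFun hr, h2,
    vecMulVec_self_mulVec, potential_eq hr]
  funext i
  have h3 := shiftedMatrix_mulVec_sq_mul_vFun hr i
  simp only [sinDotVDeriv, Pi.smul_apply, Pi.neg_apply, Pi.sub_apply, Pi.add_apply, smul_eq_mul]
  linear_combination h3

theorem sinVec_zero (μ : Fin n → ℝ) : sinVec μ 0 = 0 := by
  funext j
  simp [sinVec]

theorem vFun_zero (μ : Fin n → ℝ) (a : Fin n → ℂ) : vFun μ a 0 = 0 := by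
  rw [vFun, sinVec_zero, Matrix.mulVec_zero, neg_zero]

theorem vDeriv_zero_apply_ne_zero (hμ_pos : ∀ j, 0 < μ j)
    (hr : IsUnit (shiftedMatrix μ a 0)) (j : Fin n) :
    vDeriv μ a 0 j ≠ 0 := by
  intro h
  have h1 : Matrix.mulVec (shiftedMatrix μ a 0) (vDeriv μ a 0) j = -(μ j : ℂ) := by
    rw [vDeriv, shiftedMatrix_mulVec_inv hr, sinVec_zero]
    simp [cosVec]
  rw [shiftedMatrix_mulVec_apply, h] at h1
  simp [gramMatrix, (hμ_pos j).ne'] at h1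

theorem norm_dotProduct_le (x y : Fin n → ℂ) : ‖x ⬝ᵥ y‖ ≤ n * (‖x‖ * ‖y‖) := by
  calc _ ≤ ∑ _j : Fin n, ‖x‖ * ‖y‖ := by
        refine (norm_sum_le _ _).trans (Finset.sum_le_sum fun j _ => ?_)
        rw [norm_mul]
        exact mul_le_mul (norm_le_pi_norm x j) (norm_le_pi_norm y j) (norm_nonneg _) (norm_nonneg _)
    _ = _ := by simp

theorem norm_sinVec_le (μ : Fin n → ℝ) (r : ℝ) : ‖sinVec μ r‖ ≤ 1 := by
  refine (pi_norm_le_iff_of_nonneg zero_le_one).2 fun j => ?_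
  rw [sinVec, Complex.norm_real]
  exact Real.abs_sin_le_one _

theorem norm_cosVec_le (μ : Fin n → ℝ) (r : ℝ) : ‖cosVec μ r‖ ≤ ‖μ‖ := by
  refine (pi_norm_le_iff_of_nonneg (norm_nonneg _)).2 fun j => ?_
  rw [cosVec, Complex.norm_real, norm_mul]
  exact (mul_le_of_le_one_right (norm_nonneg _) (Real.abs_cos_le_one _)).trans (norm_le_pi_norm μ j)

/-- Both `M v = -s` and `M v' = -c - σ s` are bounded, so the lower bound on `M` controls `v` and
`v'`; then `V = 2(c·v + s·v')`. -/
theorem exists_bounds (hμ : StrictAnti μ) (hμ_pos : ∀ j, 0 < μ j)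
    (ha : ∀ j, a j ≠ 0) (ha_re : ∀ j, 0 ≤ (a j).re) :
    ∃ C : ℝ, 0 ≤ C ∧ ∀ r, 0 ≤ r → (1 + r) * ‖vFun μ a r‖ ≤ C ∧ ‖vDeriv μ a r‖ ≤ C ∧
      ‖potential μ a r‖ ≤ C := by
  obtain ⟨K, hK0, hK⟩ := exists_one_add_mul_norm_le hμ hμ_pos ha ha_re
  let D : ℝ := K * (‖μ‖ + n * K)
  have hD : 0 ≤ D := by positivity
  let E : ℝ := 2 * (n * (‖μ‖ * K) + n * D)
  have hE : 0 ≤ E := by positivity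
  refine ⟨K + D + E, by positivity, fun r hr => ?_⟩
  have hu := isUnit_shiftedMatrix hμ hμ_pos ha ha_re hr
  have h1 : (1 + r) * ‖vFun μ a r‖ ≤ K := by
    refine (hK r hr _).trans ?_
    rw [shiftedMatrix_mulVec_vFun hu, norm_neg]
    exact mul_le_of_le_one_right hK0 (norm_sinVec_le μ r)
  have le_one_add : ∀ x : Fin n → ℂ, ‖x‖ ≤ (1 + r) * ‖x‖ := fun x =>
    le_mul_of_one_le_left (norm_nonneg x) (by linarith)
  have h2 : ‖vFun μ a r‖ ≤ K := (le_one_add _).trans h1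
  have h3 : ‖sinDotV μ a r‖ ≤ n * K := by
    rw [sinDotV_eq]
    refine (norm_dotProduct_le _ _).trans ?_
    gcongr
    exact (mul_le_of_le_one_left (norm_nonneg _) (norm_sinVec_le μ r)).trans h2
  have h4 : ‖vDeriv μ a r‖ ≤ D := by
    refine ((le_one_add _).trans (hK r hr _)).trans ?_
    rw [vDeriv, shiftedMatrix_mulVec_inv hu]
    refine mul_le_mul_of_nonneg_left ((norm_sub_le _ _).trans (add_le_add ?_ ?_)) hK0
    · rw [norm_neg]
      exact norm_cosVec_le μ r
    · rw [norm_smul]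
      exact (mul_le_of_le_one_right (norm_nonneg _) (norm_sinVec_le μ r)).trans h3
  have h5 : ‖potential μ a r‖ ≤ E := by
    rw [potential_eq hu, norm_mul, Complex.norm_ofNat]
    refine mul_le_mul_of_nonneg_left ((norm_add_le _ _).trans (add_le_add ?_ ?_)) zero_le_two
    · refine (norm_dotProduct_le _ _).trans ?_
      gcongr
      exact norm_cosVec_le μ r
    · refine (norm_dotProduct_le _ _).trans ?_
      gcongr
      exact (mul_le_of_le_one_left (norm_nonneg _) (norm_sinVec_le μ r)).trans h4
  exact ⟨by linarith, by linarith, by linarith⟩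

theorem continuousOn_potential
    (hu : ∀ r, 0 ≤ r → IsUnit (shiftedMatrix μ a r)) :
    ContinuousOn (potential μ a) (Set.Ici 0) := by
  have h : ContinuousOn (fun r => 2 * sinDotVDeriv μ a r) (Set.Ici 0) := by
    intro r hr
    exact (((hasDerivAt_dotProduct (hasDerivAt_cosVec μ r) (hasDerivAt_vFun (hu r hr))).add
      (hasDerivAt_dotProduct (hasDerivAt_sinVec μ r)
        (hasDerivAt_vDeriv (hu r hr)))).const_mul 2).continuousAt.continuousWithinAt
  exact h.congr fun r hr => potential_eq (hu r hr)

end RadialSchrodinger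

/-! ### Radial profiles and the quotient `f(r)/r` as a function of `t = r²` -/

namespace RadialSchrodinger

open Filter Topology
open scoped LineDeriv

/-- `f : [0, ∞) → ℂ` is twice differentiable with derivatives `f₁`, `f₂`, it vanishes at the
origin, `f₁` is bounded, and `f₂` is continuous with `‖f₂ r‖ ≤ C r`. -/
structure IsRadialProfile (f f₁ f₂ : ℝ → ℂ) (C : ℝ) : Prop where
  map_zero : f 0 = 0
  hasDerivAt : ∀ r, 0 ≤ r → HasDerivAt f (f₁ r) r
  hasDerivAt_deriv : ∀ r, 0 ≤ r → HasDerivAt f₁ (f₂ r) r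
  nonneg : 0 ≤ C
  norm_deriv_le : ∀ r, 0 ≤ r → ‖f₁ r‖ ≤ C
  norm_deriv_deriv_le : ∀ r, 0 ≤ r → ‖f₂ r‖ ≤ C * r
  continuousOn : ContinuousOn f₂ (Set.Ici 0)

theorem norm_sub_le_of_hasDerivAt {f f' : ℝ → ℂ} {r C : ℝ} (hr : 0 ≤ r)
    (hf : ∀ s ∈ Set.Icc 0 r, HasDerivAt f (f' s) s) (hC : ∀ s ∈ Set.Icc 0 r, ‖f' s‖ ≤ C) :
    ‖f r - f 0‖ ≤ C * r := by
  have := (convex_Icc 0 r).norm_image_sub_le_of_norm_hasDerivWithin_le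
    (fun s hs => (hf s hs).hasDerivWithinAt) hC (Set.left_mem_Icc.2 hr) (Set.right_mem_Icc.2 hr)
  rwa [sub_zero, Real.norm_of_nonneg hr] at this

/-- The derivative of `f √t / √t` with respect to `t`, as a function of `r = √t`. -/
noncomputable def quotDeriv (f f₁ : ℝ → ℂ) (r : ℝ) : ℂ :=
  (r * f₁ r - f r) / (2 * r ^ 3)

/-- The second derivative of `f √t / √t` with respect to `t`, as a function of `r = √t`. -/
noncomputable def quotDerivTwo (f f₁ f₂ : ℝ → ℂ) (r : ℝ) : ℂ :=
  f₂ r / (4 * r ^ 3) - 3 * (r * f₁ r - f r) / (4 * r ^ 5)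

/-- In dimension three `Δ(U(|x|²)) = 6U' + 4|x|²U''`; here `U(t) = f(√t)/√t`. -/
theorem six_mul_quotDeriv_add (f f₁ f₂ : ℝ → ℂ) {r : ℝ} (hr : r ≠ 0) :
    6 * quotDeriv f f₁ r + 4 * r ^ 2 * quotDerivTwo f f₁ f₂ r = f₂ r / r := by
  have : (r : ℂ) ≠ 0 := by exact_mod_cast hr
  rw [quotDeriv, quotDerivTwo]
  field_simp
  ring

namespace IsRadialProfile

variable {f f₁ f₂ : ℝ → ℂ} {C : ℝ}

theorem norm_le (h : IsRadialProfile f f₁ f₂ C) {r : ℝ} (hr : 0 ≤ r) : ‖f r‖ ≤ C * r := by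
  have := norm_sub_le_of_hasDerivAt hr (fun s hs => h.hasDerivAt s hs.1)
    (fun s hs => h.norm_deriv_le s hs.1)
  rwa [h.map_zero, sub_zero] at this

/-- The derivative of `r f₁ - f` is `r f₂ = O(r²)`. The resulting cubic bound cancels the `r³` in
the denominator of `quotDeriv`. -/
theorem norm_mul_deriv_sub_le (h : IsRadialProfile f f₁ f₂ C) {r : ℝ} (hr : 0 ≤ r) :
    ‖r * f₁ r - f r‖ ≤ C * r ^ 3 := by
  have := norm_sub_le_of_hasDerivAt (f := fun s : ℝ => (s : ℂ) * f₁ s - f s)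
    (f' := fun s : ℝ => (s : ℂ) * f₂ s) (C := C * r ^ 2) hr
    (fun s hs => by
      refine (((hasDerivAt_id s).ofReal_comp.mul (h.hasDerivAt_deriv s hs.1)).sub
        (h.hasDerivAt s hs.1)).congr_deriv ?_
      simp)
    (fun s hs => by
      rw [norm_mul, Complex.norm_real, Real.norm_of_nonneg hs.1]
      have hC := h.nonneg
      calc s * ‖f₂ s‖ ≤ s * (C * s) :=
            mul_le_mul_of_nonneg_left (h.norm_deriv_deriv_le s hs.1) hs.1
        _ = C * s ^ 2 := by ring
        _ ≤ C * r ^ 2 := by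
            have := hs.1
            have := hs.2
            gcongr)
  simp only [h.map_zero, Complex.ofReal_zero, zero_mul, sub_zero] at this
  rwa [mul_assoc, ← pow_succ] at this

theorem norm_div_le (h : IsRadialProfile f f₁ f₂ C) {r : ℝ} (hr : 0 < r) : ‖f r / r‖ ≤ C := by
  rw [norm_div, Complex.norm_real, Real.norm_of_nonneg hr.le, div_le_iff₀ hr]
  exact h.norm_le hr.le

theorem norm_quotDeriv_le (h : IsRadialProfile f f₁ f₂ C) {r : ℝ} (hr : 0 < r) :
    ‖quotDeriv f f₁ r‖ ≤ C := by
  have h1 : ‖(2 * (r : ℂ) ^ 3)‖ = 2 * r ^ 3 := by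
    rw [norm_mul, norm_pow, Complex.norm_real, Real.norm_of_nonneg hr.le, Complex.norm_ofNat]
  rw [quotDeriv, norm_div, h1, div_le_iff₀ (by positivity)]
  have := h.norm_mul_deriv_sub_le hr.le
  have : 0 ≤ C * r ^ 3 := mul_nonneg h.nonneg (by positivity)
  linarith

/-- Read off from `4r²U'' = f₂/r - 6U'`: the right side is at most `7C`. -/
theorem sq_mul_norm_quotDerivTwo_le (h : IsRadialProfile f f₁ f₂ C) {r : ℝ} (hr : 0 < r) :
    r ^ 2 * ‖quotDerivTwo f f₁ f₂ r‖ ≤ 2 * C := by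
  have h1 := six_mul_quotDeriv_add f f₁ f₂ hr.ne'
  have h2 : ‖f₂ r / r‖ ≤ C := by
    rw [norm_div, Complex.norm_real, Real.norm_of_nonneg hr.le, div_le_iff₀ hr]
    exact h.norm_deriv_deriv_le r hr.le
  have h3 : 4 * (r : ℂ) ^ 2 * quotDerivTwo f f₁ f₂ r = f₂ r / r - 6 * quotDeriv f f₁ r := by
    rw [← h1]
    ring
  have h4 := congrArg norm h3
  rw [norm_mul, norm_mul, norm_pow, Complex.norm_real, Real.norm_of_nonneg hr.le,
    Complex.norm_ofNat] at h4
  have h5 := norm_sub_le (f₂ r / r) (6 * quotDeriv f f₁ r)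
  rw [norm_mul, Complex.norm_ofNat] at h5
  have h6 := h.norm_quotDeriv_le hr
  have h7 := h.nonneg
  nlinarith

theorem hasDerivAt_div_sqrt (h : IsRadialProfile f f₁ f₂ C) {t : ℝ} (ht : 0 < t) :
    HasDerivAt (fun t => f √t / (√t : ℝ)) (quotDeriv f f₁ √t) t := by
  have hr : 0 < √t := Real.sqrt_pos.2 ht
  have hr' : ((√t : ℝ) : ℂ) ≠ 0 := by exact_mod_cast hr.ne'
  have h1 : HasDerivAt (fun r : ℝ => f r / r) (2 * √t * quotDeriv f f₁ √t) √t := by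
    refine ((h.hasDerivAt _ hr.le).div (hasDerivAt_id √t).ofReal_comp hr').congr_deriv ?_
    rw [quotDeriv]
    simp only [id]
    field_simp
    push_cast
    ring
  refine (h1.scomp t (Real.hasDerivAt_sqrt ht.ne')).congr_deriv ?_
  rw [Complex.real_smul]
  push_cast
  field_simp

theorem hasDerivAt_quotDeriv_sqrt (h : IsRadialProfile f f₁ f₂ C) {t : ℝ} (ht : 0 < t) :
    HasDerivAt (fun t => quotDeriv f f₁ √t) (quotDerivTwo f f₁ f₂ √t) t := by
  have hr : 0 < √t := Real.sqrt_pos.2 ht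
  have hr' : ((√t : ℝ) : ℂ) ≠ 0 := by exact_mod_cast hr.ne'
  have h1 : HasDerivAt (quotDeriv f f₁) (2 * √t * quotDerivTwo f f₁ f₂ √t) √t := by
    have h2 := (hasDerivAt_id √t).ofReal_comp
    refine (((h2.mul (h.hasDerivAt_deriv _ hr.le)).sub (h.hasDerivAt _ hr.le)).div
      ((h2.pow 3).const_mul 2) (by simpa using hr.ne')).congr_deriv ?_
    rw [quotDerivTwo]
    simp
    field_simp
    ring
  refine (h1.scomp t (Real.hasDerivAt_sqrt ht.ne')).congr_deriv ?_
  rw [Complex.real_smul]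
  push_cast
  field_simp

theorem continuousOn_div (h : IsRadialProfile f f₁ f₂ C) :
    ContinuousOn (fun r : ℝ => f r / r) (Set.Ioi 0) := by
  refine ContinuousOn.div (fun r hr => (h.hasDerivAt r (le_of_lt hr)).continuousAt.continuousWithinAt)
    (by fun_prop) fun r hr => ?_
  exact_mod_cast (ne_of_gt hr)

theorem continuousOn_mul_deriv_sub (h : IsRadialProfile f f₁ f₂ C) :
    ContinuousOn (fun r : ℝ => r * f₁ r - f r) (Set.Ioi 0) := fun r hr =>
  ((Complex.continuous_ofReal.continuousAt.mul
    (h.hasDerivAt_deriv r (le_of_lt hr)).continuousAt).sub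
    (h.hasDerivAt r (le_of_lt hr)).continuousAt).continuousWithinAt

theorem continuousOn_quotDeriv (h : IsRadialProfile f f₁ f₂ C) :
    ContinuousOn (quotDeriv f f₁) (Set.Ioi 0) := by
  refine h.continuousOn_mul_deriv_sub.div (by fun_prop) fun r hr => ?_
  have : (r : ℂ) ≠ 0 := by exact_mod_cast (ne_of_gt hr)
  exact mul_ne_zero two_ne_zero (pow_ne_zero _ this)

theorem continuousOn_quotDerivTwo (h : IsRadialProfile f f₁ f₂ C) :
    ContinuousOn (quotDerivTwo f f₁ f₂) (Set.Ioi 0) := by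
  refine ((h.continuousOn.mono Set.Ioi_subset_Ici_self).div (by fun_prop) fun r hr => ?_).sub
    ((h.continuousOn_mul_deriv_sub.const_mul 3).div (by fun_prop) fun r hr => ?_)
  all_goals
    have : (r : ℂ) ≠ 0 := by exact_mod_cast (ne_of_gt hr)
    exact mul_ne_zero (by norm_num) (pow_ne_zero _ this)

end IsRadialProfile

/-! ### Integration by parts against Schwartz functions -/

section IntegrationByParts

variable {E : Type*} [NormedAddCommGroup E] [InnerProductSpace ℝ E]

theorem hasLineDerivAt_schwartzMap (φ : 𝓢(E, ℂ)) (x e : E) :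
    HasLineDerivAt ℝ φ (∂_{e} φ x) x e := by
  rw [SchwartzMap.lineDerivOp_apply_eq_fderiv]
  exact (φ.differentiableAt.hasFDerivAt).hasLineDerivAt e

theorem hasLineDerivAt_comp_norm_sq {U : ℝ → ℂ} {U' : ℂ} {ε : ℝ} {x : E} (e : E)
    (hU : HasDerivAt U U' (‖x‖ ^ 2 + ε)) :
    HasLineDerivAt ℝ (fun y => U (‖y‖ ^ 2 + ε)) (2 * (inner ℝ x e : ℝ) * U') x e := by
  have h1 : HasDerivAt (fun s : ℝ => x + s • e) e 0 := by
    simpa using ((hasDerivAt_id (0 : ℝ)).smul_const e).const_add x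
  have h2 := h1.norm_sq.add_const ε
  have h3 := HasDerivAt.scomp (0 : ℝ) (by simpa using hU) h2
  refine HasDerivAt.congr_deriv h3 ?_
  simp


variable [FiniteDimensional ℝ E] [MeasurableSpace E] [BorelSpace E]

theorem integrable_mul_schwartzMap {h : E → ℂ} (hm : AEStronglyMeasurable h) {C : ℝ}
    (hb : ∀ x, ‖h x‖ ≤ C * (1 + ‖x‖)) (φ : 𝓢(E, ℂ)) : Integrable fun x => h x * φ x := by
  refine Integrable.mono' (g := fun x => C * (‖φ x‖ + ‖x‖ ^ 1 * ‖φ x‖))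
    ((φ.integrable.norm.add (φ.integrable_pow_mul volume 1)).const_mul C)
    (hm.mul φ.continuous.aestronglyMeasurable) (Eventually.of_forall fun x => ?_)
  rw [norm_mul]
  calc _ ≤ C * (1 + ‖x‖) * ‖φ x‖ := by gcongr; exact hb x
    _ = _ := by ring

theorem integral_mul_lineDerivOp_eq_neg {h h' : E → ℂ} {e : E} (hc : Continuous h)
    (hc' : Continuous h') {C : ℝ} (hb : ∀ x, ‖h x‖ ≤ C * (1 + ‖x‖))
    (hb' : ∀ x, ‖h' x‖ ≤ C * (1 + ‖x‖)) (hd : ∀ x, HasLineDerivAt ℝ h (h' x) x e)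
    (φ : 𝓢(E, ℂ)) : ∫ x, h x * ∂_{e} φ x = -∫ x, h' x * φ x :=
  integral_bilinear_hasLineDerivAt_right_eq_neg_left_of_integrable
    (B := ContinuousLinearMap.mul ℝ ℂ) (v := e)
    (integrable_mul_schwartzMap hc'.aestronglyMeasurable hb' φ)
    (integrable_mul_schwartzMap hc.aestronglyMeasurable hb (∂_{e} φ))
    (integrable_mul_schwartzMap hc.aestronglyMeasurable hb φ)
    (fun x _ => hd x) (fun x _ => hasLineDerivAt_schwartzMap φ x e)

end IntegrationByParts

/-! ### The distributional Laplacian, by replacing `|x|` with `√(|x|² + ε)` -/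

section Regularized

variable {f f₁ f₂ : ℝ → ℂ} {C : ℝ}

theorem continuous_comp_sqrt_norm_sq_add {g : ℝ → ℂ} (hg : ContinuousOn g (Set.Ioi 0)) {ε : ℝ}
    (hε : 0 < ε) : Continuous fun x : R3 => g √(‖x‖ ^ 2 + ε) :=
  hg.comp_continuous (by fun_prop) fun x => Real.sqrt_pos.2 (by positivity)

theorem abs_inner_le_of_norm_eq_one {x e : R3} (he : ‖e‖ = 1) : |inner ℝ x e| ≤ ‖x‖ := by
  simpa [he] using abs_real_inner_le_norm x e

theorem IsRadialProfile.integral_regularized_lineDeriv (h : IsRadialProfile f f₁ f₂ C) {ε : ℝ}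
    (hε : 0 < ε) {e : R3} (he : ‖e‖ = 1) (φ : 𝓢(R3, ℂ)) :
    Integrable (fun x : R3 => f √(‖x‖ ^ 2 + ε) / (√(‖x‖ ^ 2 + ε) : ℝ) * ∂_{e} (∂_{e} φ) x) ∧
    Integrable (fun x : R3 => (2 * quotDeriv f f₁ √(‖x‖ ^ 2 + ε)
        + 4 * ((inner ℝ x e : ℝ) : ℂ) ^ 2 * quotDerivTwo f f₁ f₂ √(‖x‖ ^ 2 + ε)) * φ x) ∧
    ∫ x : R3, f √(‖x‖ ^ 2 + ε) / (√(‖x‖ ^ 2 + ε) : ℝ) * ∂_{e} (∂_{e} φ) x =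
      ∫ x : R3, (2 * quotDeriv f f₁ √(‖x‖ ^ 2 + ε)
        + 4 * ((inner ℝ x e : ℝ) : ℂ) ^ 2 * quotDerivTwo f f₁ f₂ √(‖x‖ ^ 2 + ε)) * φ x := by
  have hC := h.nonneg
  have hpos : ∀ x : R3, 0 < ‖x‖ ^ 2 + ε := fun x => by positivity
  have hr : ∀ x : R3, 0 < √(‖x‖ ^ 2 + ε) := fun x => Real.sqrt_pos.2 (hpos x)
  have c0 := continuous_comp_sqrt_norm_sq_add h.continuousOn_div hε
  have c1 := continuous_comp_sqrt_norm_sq_add h.continuousOn_quotDeriv hε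
  have c2 := continuous_comp_sqrt_norm_sq_add h.continuousOn_quotDerivTwo hε
  -- One constant for all three functions; the worst is the second derivative, `2·C + 4·2C = 10C`.
  have b0 : ∀ x : R3, ‖f √(‖x‖ ^ 2 + ε) / (√(‖x‖ ^ 2 + ε) : ℝ)‖ ≤ 10 * C * (1 + ‖x‖) := fun x => by
    refine (h.norm_div_le (hr x)).trans ?_
    nlinarith [norm_nonneg x, mul_nonneg hC (norm_nonneg x)]
  have b1 : ∀ x : R3, ‖2 * ((inner ℝ x e : ℝ) : ℂ) * quotDeriv f f₁ √(‖x‖ ^ 2 + ε)‖ ≤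
      10 * C * (1 + ‖x‖) := fun x => by
    rw [norm_mul, norm_mul, Complex.norm_ofNat, Complex.norm_real, Real.norm_eq_abs]
    have h1 := h.norm_quotDeriv_le (hr x)
    calc _ ≤ 2 * ‖x‖ * C := by
          gcongr
          exact abs_inner_le_of_norm_eq_one he
      _ ≤ _ := by nlinarith [norm_nonneg x, mul_nonneg hC (norm_nonneg x)]
  have b2 : ∀ x : R3, ‖2 * quotDeriv f f₁ √(‖x‖ ^ 2 + ε)
        + 4 * ((inner ℝ x e : ℝ) : ℂ) ^ 2 * quotDerivTwo f f₁ f₂ √(‖x‖ ^ 2 + ε)‖ ≤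
      10 * C * (1 + ‖x‖) := fun x => by
    have h1 := h.norm_quotDeriv_le (hr x)
    have h2 := h.sq_mul_norm_quotDerivTwo_le (hr x)
    rw [Real.sq_sqrt (hpos x).le] at h2
    have h3 : (inner ℝ x e : ℝ) ^ 2 ≤ ‖x‖ ^ 2 + ε := by
      have := sq_le_sq' (by linarith [abs_le.1 (abs_inner_le_of_norm_eq_one (x := x) he)])
        (abs_le.1 (abs_inner_le_of_norm_eq_one (x := x) he)).2
      linarith
    have h4 : (inner ℝ x e : ℝ) ^ 2 * ‖quotDerivTwo f f₁ f₂ √(‖x‖ ^ 2 + ε)‖ ≤ 2 * C :=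
      (mul_le_mul_of_nonneg_right h3 (norm_nonneg _)).trans h2
    refine (norm_add_le _ _).trans ?_
    rw [norm_mul, norm_mul, norm_mul, Complex.norm_ofNat, Complex.norm_ofNat, norm_pow,
      Complex.norm_real, Real.norm_eq_abs, sq_abs]
    nlinarith [mul_nonneg hC (norm_nonneg x)]
  have d0 : ∀ x : R3, HasLineDerivAt ℝ
      (fun x : R3 => f √(‖x‖ ^ 2 + ε) / (√(‖x‖ ^ 2 + ε) : ℝ))
      (2 * ((inner ℝ x e : ℝ) : ℂ) * quotDeriv f f₁ √(‖x‖ ^ 2 + ε)) x e := fun x =>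
    hasLineDerivAt_comp_norm_sq (U := fun t => f √t / (√t : ℝ)) e (h.hasDerivAt_div_sqrt (hpos x))
  have d1 : ∀ x : R3, HasLineDerivAt ℝ
      (fun x : R3 => 2 * ((inner ℝ x e : ℝ) : ℂ) * quotDeriv f f₁ √(‖x‖ ^ 2 + ε))
      (2 * quotDeriv f f₁ √(‖x‖ ^ 2 + ε)
        + 4 * ((inner ℝ x e : ℝ) : ℂ) ^ 2 * quotDerivTwo f f₁ f₂ √(‖x‖ ^ 2 + ε)) x e := fun x => by
    have h1 : HasDerivAt (fun s : ℝ => quotDeriv f f₁ √(‖x + s • e‖ ^ 2 + ε)) _ 0 :=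
      hasLineDerivAt_comp_norm_sq (U := fun t => quotDeriv f f₁ √t) e
        (h.hasDerivAt_quotDeriv_sqrt (hpos x))
    have h2 : HasDerivAt (fun s : ℝ => inner ℝ (x + s • e) e) 1 0 := by
      simp only [inner_add_left, real_inner_smul_left, real_inner_self_eq_norm_sq, he, one_pow,
        mul_one]
      exact (hasDerivAt_id (0 : ℝ)).const_add _
    refine HasDerivAt.congr_deriv ((h2.ofReal_comp.const_mul 2).mul h1) ?_
    simp only [zero_smul, add_zero]
    push_cast
    ring
  refine ⟨integrable_mul_schwartzMap c0.aestronglyMeasurable b0 _,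
    integrable_mul_schwartzMap (Continuous.aestronglyMeasurable (by fun_prop)) b2 φ, ?_⟩
  rw [integral_mul_lineDerivOp_eq_neg c0 (by fun_prop) b0 b1 d0,
    integral_mul_lineDerivOp_eq_neg (by fun_prop) (by fun_prop) b1 b2 d1, neg_neg]

theorem IsRadialProfile.integral_regularized (h : IsRadialProfile f f₁ f₂ C) {ε : ℝ}
    (hε : 0 < ε) (φ : 𝓢(R3, ℂ)) :
    ∫ x : R3, f √(‖x‖ ^ 2 + ε) / (√(‖x‖ ^ 2 + ε) : ℝ) * (Δ φ) x =
      ∫ x : R3, (6 * quotDeriv f f₁ √(‖x‖ ^ 2 + ε)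
        + 4 * (‖x‖ : ℂ) ^ 2 * quotDerivTwo f f₁ f₂ √(‖x‖ ^ 2 + ε)) * φ x := by
  let b := EuclideanSpace.basisFun (Fin 3) ℝ
  have hb := fun i => h.integral_regularized_lineDeriv hε (b.orthonormal.1 i) φ
  have h1 : ∀ x : R3, f √(‖x‖ ^ 2 + ε) / (√(‖x‖ ^ 2 + ε) : ℝ) * (Δ φ) x =
      ∑ i, f √(‖x‖ ^ 2 + ε) / (√(‖x‖ ^ 2 + ε) : ℝ) * ∂_{b i} (∂_{b i} φ) x := fun x => by
    rw [SchwartzMap.laplacian_eq_sum b, sum_apply, Finset.mul_sum]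
  have h2 : ∀ x : R3, (6 * quotDeriv f f₁ √(‖x‖ ^ 2 + ε)
        + 4 * (‖x‖ : ℂ) ^ 2 * quotDerivTwo f f₁ f₂ √(‖x‖ ^ 2 + ε)) * φ x =
      ∑ i, (2 * quotDeriv f f₁ √(‖x‖ ^ 2 + ε)
        + 4 * ((inner ℝ x (b i) : ℝ) : ℂ) ^ 2 * quotDerivTwo f f₁ f₂ √(‖x‖ ^ 2 + ε)) * φ x :=
    fun x => by
      have h3 := congrArg (fun t : ℝ => (t : ℂ)) (b.sum_sq_inner_left x)
      simp only [Complex.ofReal_sum, Complex.ofReal_pow] at h3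
      rw [Fin.sum_univ_three] at h3 ⊢
      linear_combination -4 * quotDerivTwo f f₁ f₂ √(‖x‖ ^ 2 + ε) * φ x * h3
  simp_rw [h1, h2]
  rw [integral_finsetSum _ fun i _ => (hb i).1, integral_finsetSum _ fun i _ => (hb i).2.1]
  exact Finset.sum_congr rfl fun i _ => (hb i).2.2

/-- A radial function `f(|x|) / |x|` has the distributional Laplacian `f''(|x|) / |x|`. -/
theorem IsRadialProfile.integral_mul_laplacian (h : IsRadialProfile f f₁ f₂ C) (φ : 𝓢(R3, ℂ)) :
    ∫ x : R3, f ‖x‖ / (‖x‖ : ℝ) * (Δ φ) x = ∫ x : R3, f₂ ‖x‖ / (‖x‖ : ℝ) * φ x := by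
  have hC := h.nonneg
  have hpos : ∀ ε : ℝ, 0 < ε → ∀ x : R3, 0 < ‖x‖ ^ 2 + ε := fun ε hε x => by positivity
  have hr : ∀ ε : ℝ, 0 < ε → ∀ x : R3, 0 < √(‖x‖ ^ 2 + ε) := fun ε hε x =>
    Real.sqrt_pos.2 (hpos ε hε x)
  have hlim : ∀ {g : ℝ → ℂ}, ContinuousOn g (Set.Ioi 0) → ∀ x : R3, x ≠ 0 →
      Tendsto (fun ε : ℝ => g √(‖x‖ ^ 2 + ε)) (𝓝[>] 0) (𝓝 (g ‖x‖)) := by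
    intro g hg x hx
    have h1 : Tendsto (fun ε : ℝ => √(‖x‖ ^ 2 + ε)) (𝓝[>] 0) (𝓝 ‖x‖) := by
      have : Continuous fun ε : ℝ => √(‖x‖ ^ 2 + ε) := by fun_prop
      have h2 := this.tendsto 0
      rw [add_zero, Real.sqrt_sq (norm_nonneg x)] at h2
      exact h2.mono_left nhdsWithin_le_nhds
    exact (hg.continuousAt (Ioi_mem_nhds (norm_pos_iff.2 hx))).tendsto.comp h1
  have hne : ∀ᵐ x : R3, x ≠ 0 := by
    simp [ae_iff]
  have t1 : Tendsto (fun ε : ℝ => ∫ x : R3,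
      f √(‖x‖ ^ 2 + ε) / (√(‖x‖ ^ 2 + ε) : ℝ) * (Δ φ) x) (𝓝[>] 0)
      (𝓝 (∫ x : R3, f ‖x‖ / (‖x‖ : ℝ) * (Δ φ) x)) := by
    refine tendsto_integral_filter_of_dominated_convergence (fun x => C * ‖(Δ φ) x‖) ?_ ?_
      ((Δ φ).integrable.norm.const_mul C) ?_
    · filter_upwards [self_mem_nhdsWithin] with ε hε
      exact ((continuous_comp_sqrt_norm_sq_add h.continuousOn_div hε).mul
        (Δ φ).continuous).aestronglyMeasurable
    · filter_upwards [self_mem_nhdsWithin] with ε hε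
      refine Eventually.of_forall fun x => ?_
      rw [norm_mul]
      gcongr
      exact h.norm_div_le (hr ε hε x)
    · filter_upwards [hne] with x hx
      exact (hlim h.continuousOn_div x hx).mul_const _
  -- The coefficient is `|x|²`, not `|x|² + ε`, so the integrand becomes `f₂(r)/r` only in the
  -- limit. The dominating constant is `6·C + 4·2C = 14C`.
  have t2 : Tendsto (fun ε : ℝ => ∫ x : R3, (6 * quotDeriv f f₁ √(‖x‖ ^ 2 + ε)
        + 4 * (‖x‖ : ℂ) ^ 2 * quotDerivTwo f f₁ f₂ √(‖x‖ ^ 2 + ε)) * φ x) (𝓝[>] 0)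
      (𝓝 (∫ x : R3, f₂ ‖x‖ / (‖x‖ : ℝ) * φ x)) := by
    refine tendsto_integral_filter_of_dominated_convergence (fun x => 14 * C * ‖φ x‖) ?_ ?_
      (φ.integrable.norm.const_mul (14 * C)) ?_
    · filter_upwards [self_mem_nhdsWithin] with ε hε
      have c1 := continuous_comp_sqrt_norm_sq_add h.continuousOn_quotDeriv hε
      have c2 := continuous_comp_sqrt_norm_sq_add h.continuousOn_quotDerivTwo hε
      exact Continuous.aestronglyMeasurable (by fun_prop)
    · filter_upwards [self_mem_nhdsWithin] with ε hε
      refine Eventually.of_forall fun x => ?_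
      rw [norm_mul]
      refine mul_le_mul_of_nonneg_right ?_ (norm_nonneg _)
      refine (norm_add_le _ _).trans ?_
      rw [norm_mul, norm_mul, norm_mul, Complex.norm_ofNat, Complex.norm_ofNat, norm_pow,
        Complex.norm_real, norm_norm]
      have h1 := h.norm_quotDeriv_le (hr ε hε x)
      have h2 := h.sq_mul_norm_quotDerivTwo_le (hr ε hε x)
      rw [Real.sq_sqrt (hpos ε hε x).le, add_mul] at h2
      have h3 : 0 ≤ ε * ‖quotDerivTwo f f₁ f₂ √(‖x‖ ^ 2 + ε)‖ :=
        mul_nonneg (le_of_lt hε) (norm_nonneg _)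
      linarith
    · filter_upwards [hne] with x hx
      rw [← six_mul_quotDeriv_add f f₁ f₂ (norm_ne_zero_iff.2 hx)]
      exact (((hlim h.continuousOn_quotDeriv x hx).const_mul _).add
        ((hlim h.continuousOn_quotDerivTwo x hx).const_mul _)).mul_const _
  refine tendsto_nhds_unique t1 (t2.congr' ?_)
  filter_upwards [self_mem_nhdsWithin] with ε hε
  exact (h.integral_regularized hε φ).symm

end Regularized

end RadialSchrodinger

/-! ### Sobolev regularity and the eigenvalue equation -/

namespace RadialSchrodinger

open Filter Topology

/-- The symbol at order two is `1 + ‖ξ‖²`, while `Δ` has symbol `-(2π)²‖ξ‖²`. -/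
theorem besselPotential_two_eq (f : 𝓢'(R3, ℂ)) :
    besselPotential R3 ℂ 2 f = f - (((2 * Real.pi) ^ 2)⁻¹ : ℝ) • Δ f := by
  have h1 : (fun x : R3 => (((1 + ‖x‖ ^ 2) ^ ((2 : ℝ) / 2) : ℝ) : ℂ)) =
      (fun _ : R3 => (1 : ℂ)) + fun x : R3 => Complex.ofReal (‖x‖ ^ 2) := by
    funext x
    simp
  have h2 : fourierMultiplierCLM ℂ ((fun _ : R3 => (1 : ℂ)) + fun x : R3 => Complex.ofReal (‖x‖ ^ 2))
      f = fourierMultiplierCLM ℂ (fun _ : R3 => (1 : ℂ)) f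
        + fourierMultiplierCLM ℂ (fun x : R3 => Complex.ofReal (‖x‖ ^ 2)) f := by
    ext u
    simp only [fourierMultiplierCLM_apply_apply, add_apply]
    rw [SchwartzMap.smulLeftCLM_add (by fun_prop) (by fun_prop)]
    simp
  have h3 : (((2 * Real.pi) ^ 2)⁻¹ : ℝ) * -(2 * Real.pi) ^ 2 = -1 := by
    have := Real.pi_ne_zero
    field_simp
  rw [besselPotential, h1, h2, laplacian_eq_fourierMultiplierCLM, smul_smul, h3]
  simp

theorem memSobolev_two_of_laplacian_eq {f g : L2R3} (h : Δ (f : 𝓢'(R3, ℂ)) = (g : 𝓢'(R3, ℂ))) :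
    MemSobolev 2 2 (f : 𝓢'(R3, ℂ)) := by
  refine ⟨f - ((((2 * Real.pi) ^ 2)⁻¹ : ℝ) : ℂ) • g, ?_⟩
  rw [besselPotential_two_eq, h]
  simp only [← Lp.toTemperedDistributionCLM_apply, map_sub, map_smul]
  rfl

variable {n : ℕ} {μ : Fin n → ℝ} {a : Fin n → ℂ}

theorem exists_isRadialProfile (hμ : StrictAnti μ) (hμ_pos : ∀ j, 0 < μ j)
    (ha : ∀ j, a j ≠ 0) (ha_re : ∀ j, 0 ≤ (a j).re) (j : Fin n) :
    ∃ C, IsRadialProfile (fun r => vFun μ a r j) (fun r => vDeriv μ a r j)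
      (fun r => (potential μ a r - (μ j : ℂ) ^ 2) * vFun μ a r j) C := by
  have hu := fun r (hr : 0 ≤ r) => isUnit_shiftedMatrix hμ hμ_pos ha ha_re hr
  obtain ⟨C, hC0, hC⟩ := exists_bounds hμ hμ_pos ha ha_re
  have hv : ∀ r, 0 ≤ r → HasDerivAt (fun r => vFun μ a r j) (vDeriv μ a r j) r := fun r hr =>
    hasDerivAt_pi.1 (hasDerivAt_vFun (hu r hr)) j
  have hv' : ∀ r, 0 ≤ r → ‖vDeriv μ a r j‖ ≤ C := fun r hr =>
    (norm_le_pi_norm _ j).trans (hC r hr).2.1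
  have h0 : vFun μ a 0 j = 0 := by rw [vFun_zero, Pi.zero_apply]
  refine ⟨C + (C + μ j ^ 2) * C, h0, hv,
    fun r hr => hasDerivAt_pi.1 (hasDerivAt_vDeriv (hu r hr)) j, by positivity, fun r hr => ?_,
    fun r hr => ?_, ?_⟩
  · exact (hv' r hr).trans (le_add_of_nonneg_right (by positivity))
  -- `v_j(0) = 0` and bounded `v_j'` give `|v_j| ≤ C r`, which supplies the factor `r` required of
  -- `f₂`.
  · have h1 := norm_sub_le_of_hasDerivAt hr (fun s hs => hv s hs.1) (fun s hs => hv' s hs.1)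
    rw [h0, sub_zero] at h1
    have h2 : ‖potential μ a r - (μ j : ℂ) ^ 2‖ ≤ C + μ j ^ 2 := by
      refine (norm_sub_le _ _).trans (add_le_add (hC r hr).2.2 ?_)
      rw [norm_pow, Complex.norm_real, Real.norm_eq_abs, sq_abs]
    rw [norm_mul]
    calc _ ≤ (C + μ j ^ 2) * (C * r) := by gcongr
      _ ≤ _ := by nlinarith [mul_nonneg hC0 hr]
  · exact ((continuousOn_potential hu).sub continuousOn_const).mul
      fun r hr => (hv r hr).continuousAt.continuousWithinAt

theorem measurable_uFun (hu : ∀ r, 0 ≤ r → IsUnit (shiftedMatrix μ a r)) (j : Fin n) :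
    Measurable (uFun μ a j) := by
  have h : ContinuousOn (fun r => vFun μ a r j) (Set.Ici 0) := fun r hr =>
    (hasDerivAt_pi.1 (hasDerivAt_vFun (hu r hr)) j).continuousAt.continuousWithinAt
  have h1 : Continuous fun x : R3 => vFun μ a ‖x‖ j :=
    h.comp_continuous continuous_norm fun x => norm_nonneg x
  exact h1.measurable.div (by fun_prop)

theorem memLp_uFun (hμ : StrictAnti μ) (hμ_pos : ∀ j, 0 < μ j)
    (ha : ∀ j, a j ≠ 0) (ha_re : ∀ j, 0 ≤ (a j).re) (j : Fin n) :
    MemLp (uFun μ a j) 2 (volume : Measure R3) := by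
  have hu := fun r (hr : 0 ≤ r) => isUnit_shiftedMatrix hμ hμ_pos ha ha_re hr
  obtain ⟨C, hC0, hC⟩ := exists_bounds hμ hμ_pos ha ha_re
  obtain ⟨D, hD⟩ := exists_isRadialProfile hμ hμ_pos ha ha_re j
  have hD0 := hD.nonneg
  -- For `|x| ≤ 1` use `|u_j| ≤ D`; for `|x| ≥ 1` use `1 + |x| ≤ 2|x|` and the decay of `v_j`. At `x
  -- = 0` division by zero makes `u_j` vanish. Squaring yields `(1 + |x|)⁻⁴`, integrable since `4 >
  -- 3`.
  have hb : ∀ x : R3, (1 + ‖x‖) ^ 2 * ‖uFun μ a j x‖ ≤ 4 * D + 2 * C := fun x => by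
    rcases (norm_nonneg x).eq_or_lt with h0 | h0
    · rw [uFun, ← h0]
      simp
      positivity
    have h1 : ‖uFun μ a j x‖ ≤ D := hD.norm_div_le h0
    rcases le_total ‖x‖ 1 with hx | hx
    · calc _ ≤ (1 + 1) ^ 2 * D := by gcongr
        _ ≤ _ := by linarith
    · have h2 : ‖x‖ * ‖uFun μ a j x‖ = ‖vFun μ a ‖x‖ j‖ := by
        rw [uFun, norm_div, Complex.norm_real, norm_norm]
        field_simp
      have h3 : (1 + ‖x‖) * ‖vFun μ a ‖x‖ j‖ ≤ C :=
        (mul_le_mul_of_nonneg_left (norm_le_pi_norm _ j) (by positivity)).trans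
          (hC _ h0.le).1
      calc _ ≤ (1 + ‖x‖) * (2 * ‖x‖) * ‖uFun μ a j x‖ := by
            rw [pow_two]
            gcongr
            linarith
        _ = 2 * ((1 + ‖x‖) * (‖x‖ * ‖uFun μ a j x‖)) := by ring
        _ ≤ _ := by rw [h2]; linarith
  have hm := (measurable_uFun hu j).aestronglyMeasurable (μ := (volume : Measure R3))
  refine (memLp_two_iff_integrable_sq_norm hm).2 ?_
  have hint : Integrable (fun x : R3 => (4 * D + 2 * C) ^ 2 * (1 + ‖x‖) ^ (-4 : ℝ)) :=
    (integrable_one_add_norm (by simp; norm_num)).const_mul _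
  refine hint.mono' (hm.norm.pow 2) (Eventually.of_forall fun x => ?_)
  have hp : 0 < 1 + ‖x‖ := by positivity
  rw [Real.rpow_neg hp.le, ← div_eq_mul_inv, le_div_iff₀ (by positivity), Real.norm_of_nonneg
    (by positivity)]
  have h4 : (1 + ‖x‖) ^ (4 : ℝ) = ((1 + ‖x‖) ^ 2) ^ 2 := by
    rw [← pow_mul]
    exact_mod_cast Real.rpow_natCast (1 + ‖x‖) 4
  rw [h4, ← mul_pow, mul_comm]
  exact pow_le_pow_left₀ (by positivity) (hb x) 2

theorem memLp_potential (hμ : StrictAnti μ) (hμ_pos : ∀ j, 0 < μ j)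
    (ha : ∀ j, a j ≠ 0) (ha_re : ∀ j, 0 ≤ (a j).re) :
    MemLp (fun x : R3 => potential μ a ‖x‖) ∞ (volume : Measure R3) := by
  obtain ⟨C, hC0, hC⟩ := exists_bounds hμ hμ_pos ha ha_re
  have hm : Measurable fun x : R3 => potential μ a ‖x‖ :=
    ((measurable_deriv (sinDotV μ a)).const_mul 2).comp measurable_norm
  exact memLp_top_of_bound hm.aestronglyMeasurable C
    (Eventually.of_forall fun x => (hC _ (norm_nonneg x)).2.2)

/-- As `v_j'(0) ≠ 0`, `v_j` has no zero in a punctured neighbourhood of `0`, so `u_j ≠ 0` on a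
punctured ball. -/
theorem not_ae_eq_zero_uFun (hμ_pos : ∀ j, 0 < μ j) (hu : IsUnit (shiftedMatrix μ a 0))
    (j : Fin n) : ¬ uFun μ a j =ᵐ[(volume : Measure R3)] 0 := by
  intro h
  have h1 := (hasDerivAt_pi.1 (hasDerivAt_vFun hu) j).eventually_ne (c := 0)
    (vDeriv_zero_apply_ne_zero hμ_pos hu j)
  obtain ⟨δ, hδ, h2⟩ := Metric.mem_nhdsWithin_iff.1 h1
  have h3 : Metric.ball (0 : R3) δ ⊆ {x | ¬ uFun μ a j x = (0 : R3 → ℂ) x} ∪ {0} := by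
    intro x hx
    by_cases hx0 : x = 0
    · exact Or.inr hx0
    · have hx' : 0 < ‖x‖ := norm_pos_iff.2 hx0
      have : vFun μ a ‖x‖ j ≠ 0 := h2 ⟨by simpa using hx, hx'.ne'⟩
      exact Or.inl (div_ne_zero this (by exact_mod_cast hx'.ne'))
  have h4 := measure_mono_null h3 (measure_union_null (ae_iff.1 h) (measure_singleton _))
  exact (Metric.measure_ball_pos volume (0 : R3) hδ).ne' h4

theorem laplacian_toLp_uFun (hμ : StrictAnti μ) (hμ_pos : ∀ j, 0 < μ j)
    (ha : ∀ j, a j ≠ 0) (ha_re : ∀ j, 0 ≤ (a j).re) (j : Fin n)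
    (hV : MemLp (fun x : R3 => potential μ a ‖x‖) ∞ (volume : Measure R3))
    (hu : MemLp (uFun μ a j) 2 (volume : Measure R3)) :
    Δ ((hu.toLp : L2R3) : 𝓢'(R3, ℂ)) =
      ((mulOp hV.toLp hu.toLp - (((μ j) ^ 2 : ℝ) : ℂ) • hu.toLp : L2R3) : 𝓢'(R3, ℂ)) := by
  obtain ⟨D, hD⟩ := exists_isRadialProfile hμ hμ_pos ha ha_re j
  ext φ
  rw [laplacian_apply_apply, Lp.toTemperedDistribution_apply, Lp.toTemperedDistribution_apply]
  trans ∫ x : R3, vFun μ a ‖x‖ j / (‖x‖ : ℝ) * (Δ φ) x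
  · refine integral_congr_ae ?_
    filter_upwards [hu.coeFn_toLp] with x hx
    rw [hx, smul_eq_mul, mul_comm, uFun]
  · rw [hD.integral_mul_laplacian φ]
    refine integral_congr_ae ?_
    filter_upwards [hu.coeFn_toLp, hV.coeFn_toLp, mulOp_coeFn hV.toLp hu.toLp,
      Lp.coeFn_sub (mulOp hV.toLp hu.toLp) ((((μ j) ^ 2 : ℝ) : ℂ) • hu.toLp),
      Lp.coeFn_smul (((μ j) ^ 2 : ℝ) : ℂ) hu.toLp] with x h1 h2 h3 h4 h5
    rw [h4, Pi.sub_apply, h5, Pi.smul_apply, h3, h1, h2, uFun, smul_eq_mul, smul_eq_mul]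
    push_cast
    ring

end RadialSchrodinger

theorem mainTheorem2 (n : ℕ) (μ : Fin n → ℝ) (hμ : StrictAnti μ) (hμ_pos : ∀ j, 0 < μ j)
    (a : Fin n → ℂ) (ha : ∀ j, a j ≠ 0) (ha_re : ∀ j, 0 ≤ (a j).re) :
    (∀ r : ℝ, 0 ≤ r → IsUnit (RadialSchrodinger.shiftedMatrix μ a r)) ∧
    (∀ r : ℝ, 0 ≤ r → DifferentiableAt ℝ (RadialSchrodinger.sinDotV μ a) r) ∧
    ∃ hV : MemLp (fun x : RadialSchrodinger.R3 => RadialSchrodinger.potential μ a ‖x‖) ∞ volume,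
      ∀ j : Fin n,
        ∃ hu : MemLp (RadialSchrodinger.uFun μ a j) 2 volume,
          hu.toLp ≠ 0 ∧
          ∃ hdom : hu.toLp ∈ (RadialSchrodinger.schrodingerOp hV.toLp).domain,
            RadialSchrodinger.schrodingerOp hV.toLp ⟨hu.toLp, hdom⟩ =
              (((μ j) ^ 2 : ℝ) : ℂ) • hu.toLp := by
  open RadialSchrodinger in
  have hunit := fun r (hr : 0 ≤ r) => isUnit_shiftedMatrix hμ hμ_pos ha ha_re hr
  refine ⟨hunit, fun r hr => (hasDerivAt_sinDotV (hunit r hr)).differentiableAt,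
    memLp_potential hμ hμ_pos ha ha_re, fun j => ⟨memLp_uFun hμ hμ_pos ha ha_re j, ?_, ?_⟩⟩
  · intro h
    refine not_ae_eq_zero_uFun hμ_pos (hunit 0 le_rfl) j ?_
    exact ((memLp_uFun hμ hμ_pos ha ha_re j).coeFn_toLp).symm.trans
      (by rw [h]; exact Lp.coeFn_zero _ _ _)
  · have hlap := laplacian_toLp_uFun hμ hμ_pos ha ha_re j (memLp_potential hμ hμ_pos ha ha_re)
      (memLp_uFun hμ hμ_pos ha ha_re j)
    have hdom := memSobolev_two_of_laplacian_eq hlap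
    refine ⟨hdom, ?_⟩
    -- `laplacianH2` is defined by choice; injectivity of `L²` into distributions identifies its
    -- value.
    have h1 := toTemperedDistribution_injective ((laplacianH2_spec ⟨_, hdom⟩).symm.trans hlap)
    change -laplacianH2 ⟨_, hdom⟩ + mulOp _ _ = _
    rw [h1, neg_sub]
    exact sub_add_cancel _ _
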